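/- Consider the following two-player game $BS_2(\mathcal{P}_4 : p,q)$. It starts with two spots in the plane, having $p$ and $q$ open tips respectively and no curves. A move consists of joining two open tips by a curve that does not cross anything drawn so far, and then drawing a crossbar on that curve, which creates two new open tips, one on each side of the curve. The graph whose vertices are the spots and the crossings of curves with their crossbars, and whose edges are the pieces of curves joining two such vertices, must at all times be a (simple) planar graph of girth at least $4$. The play ends when no valid move exists. Theorem. Let $p, q \ge 3$ be integers with $p \le q \le 2p$. Then there is a play of $BS_2(\mathcal{P}_4 : p,q)$ that ends after exactly $p+q$ moves, and there is a play of $BS_2(\mathcal{P}_4 : p,q)$ that ends after exactly $6$ moves. -/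

import Mathlib

/-!
# Generalized Brussels sprout for planar graphs of girth at least `g`

A position is a drawing on the plane (equivalently, on the sphere) without crossings, recorded up to
homeomorphism by the usual combinatorial data: the rotation of the arms around every vertex, the
pairing of arms into edges, and the face of the drawing in which every arm lies.
-/

namespace BrusselsSprout

/-- The arms (half-edges and open tips): arm `j` of spot `i` is `Sum.inl ⟨i, j⟩`, and
`Sum.inr (k, s)` with `s = 0, 1, 2, 3` are the four arms, in rotational order, at the crossing of
the `k`-th curve (counted from `0`) with its crossbar. -/
abbrev Arm {n : ℕ} (t : Fin n → ℕ) : Type := (Σ i : Fin n, Fin (t i)) ⊕ (ℕ × Fin 4)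

/-- The vertices: the `n` initial spots, and one vertex for every crossbar. -/
abbrev Vertex (n : ℕ) : Type := Fin n ⊕ ℕ

/-- The vertex at which an arm is attached. -/
def vert {n : ℕ} {t : Fin n → ℕ} : Arm t → Vertex n := Sum.map Sigma.fst Prod.fst

/-- The next arm in the rotation around its vertex. -/
def next {n : ℕ} (t : Fin n → ℕ) : Equiv.Perm (Arm t) :=
  Equiv.sumCongr (Equiv.sigmaCongrRight fun i => finRotate (t i))
    (Equiv.prodCongr (Equiv.refl ℕ) (finRotate 4))

/-- The data of a position. -/
structure Position {n : ℕ} (t : Fin n → ℕ) where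
  /-- The number of curves drawn so far. -/
  moves : ℕ
  /-- The pairing of half-edges into edges: `opp d` is the other half of the edge that contains `d`,
  and `opp d = d` if `d` is an open tip (or is not drawn yet). -/
  opp : Equiv.Perm (Arm t)
  /-- The name of the face of the drawing that contains the open tip `d`, or, if `d` is a half-edge,
  of the face next to `d` on the side from which `d` is followed in a boundary walk. -/
  face : Arm t → ℕ

/-- The initial position: `n` spots with `t i` open tips at spot `i`, no curves, one face. -/
def initial {n : ℕ} (t : Fin n → ℕ) : Position t where
  moves := 0
  opp := 1
  face := fun _ => 0

namespace Position

variable {n : ℕ} {t : Fin n → ℕ}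

/-- The arms that are drawn in the position: those of the spots and of the crossbars so far. -/
def Drawn (P : Position t) : Arm t → Prop
  | Sum.inl _ => True
  | Sum.inr (k, _) => k < P.moves

/-- The open tips. -/
def IsTip (P : Position t) (d : Arm t) : Prop := P.Drawn d ∧ P.opp d = d

/-- One step of the walk along the boundary of a face: follow an edge to its other half (or go
around an open tip), then turn to the next arm. The cycles are the boundary components of the faces;
a face has several of them if the drawn graph is disconnected. -/
def boundaryStep (P : Position t) : Equiv.Perm (Arm t) := next t * P.opp

/-- The graph of the position, without regard to multiplicities of edges. -/
def graph (P : Position t) : SimpleGraph (Vertex n) :=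
  SimpleGraph.fromRel fun v w => ∃ d, P.opp d ≠ d ∧ vert d = v ∧ vert (P.opp d) = w

/-- The graph of the position is a simple graph of girth at least `g`: no loop, no two parallel
edges, no cycle of length less than `g`. It is planar since it is drawn without crossings. -/
structure GirthAtLeast (g : ℕ) (P : Position t) : Prop where
  no_loop : ∀ d, P.opp d ≠ d → vert (P.opp d) ≠ vert d
  no_parallel : ∀ d e, P.opp d ≠ d → P.opp e ≠ e → vert d = vert e →
    vert (P.opp d) = vert (P.opp e) → d = e
  girth : (g : ℕ∞) ≤ P.graph.egirth

/-- `Q` arises from `P` by joining the open tips `a ≠ b`, which lie in the same face, by a curve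
inside that face, and drawing a crossbar on the curve.

Arms `0` and `2` of the new vertex complete the edges to `a` and to `b`, and arms `1` and `3`, on
the two sides of the curve, are new open tips. If `a` and `b` lie on the same component of the
boundary of their face, then the curve divides this face into two, one of which gets a new name;
the boundary components that the curve does not touch may go to either of the two. If `a` and `b`
lie on different components, then the face is not divided. The other faces do not change. -/
structure Join (P Q : Position t) (a b : Arm t) : Prop where
  tip_left : P.IsTip a
  tip_right : P.IsTip b
  ne : a ≠ b
  same_face : P.face a = P.face b
  moves_eq : Q.moves = P.moves + 1
  opp_eq : Q.opp =
    P.opp * Equiv.swap a (Sum.inr (P.moves, 0)) * Equiv.swap b (Sum.inr (P.moves, 2))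
  face_drawn : ∀ d, P.Drawn d → Q.face d = P.face d ∨
    (P.boundaryStep.SameCycle a b ∧ P.face d = P.face a ∧ Q.face d = P.moves + 1)
  face_ne : P.boundaryStep.SameCycle a b → Q.face a ≠ Q.face b
  face_boundary : ∀ d, Q.Drawn d → Q.face (Q.boundaryStep d) = Q.face d

/-- A valid move of the game for the family of planar graphs of girth at least `g`. -/
def Move (g : ℕ) (P Q : Position t) : Prop := (∃ a b, P.Join Q a b) ∧ Q.GirthAtLeast g

end Position

/-- The `n`-Brussels sprout game with parameters `t`, for the family of planar graphs of girth at
least `g`, has a play that ends after exactly `N` moves: `N` successive valid moves lead from the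
initial position to a position without valid moves. -/
def HasPlayEndingAfter (g : ℕ) {n : ℕ} (t : Fin n → ℕ) (N : ℕ) : Prop :=
  ∃ s : ℕ → Position t, s 0 = initial t ∧ (∀ i < N, (s i).Move g (s (i + 1))) ∧
    ∀ Q, ¬ (s N).Move g Q

end BrusselsSprout

/-! ### Triangles, and lists read as cycles -/

namespace BrusselsSprout

open Equiv

set_option linter.unusedSectionVars false

/-! A move inserts a new crossing between two tips. So it keeps the girth at least 4 exactly when
the tips belong to distinct nonadjacent vertices: equal vertices would give parallel edges, adjacent
ones a triangle (`girthAtLeast_join`, `nonadj_of_girthAtLeast_join`). Once the first move has joined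
the two spots the drawing is connected, every face has one boundary cycle, and every further move
splits one such cycle into two. A face can therefore be replaced by the cyclic word of the vertices
of its tips: joining x and y in x u y v leaves the words z u and z v with z the new crossing
(`Stage.exists_move`). A face is dead when any two letters of its word are equal or adjacent; it
stays dead because edges are never removed, and the play is over when all faces are dead.

Let the spots be α and β, with p and q tips. The first move leaves one face, k β^(q-1) k' α^(p-1)
with k = k'. The spots never become adjacent, so they can be joined again and again.

For p + q moves (`Stage.endsAfter_mainWord`), joining the β next to k with the α next to k cuts off
a face z k, which supplies one more move, and leaves a main face of the same shape with z in place
of k. These two moves spend one tip of each spot. Skipping one β cuts off z k β instead, which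
supplies two more moves; then three moves spend three tips. Choosing between the two uses up all
tips of α with at most one β left, and the rest is worth one or two moves. This needs p ≤ q ≤ 2p.

For 6 moves (`Stage.endsAfter_five`), one such round makes the two crossings of the main face
distinct. Joining them separates the tips of α from those of β, and one more move on each side makes
the crossing left there adjacent to the spot, which kills all remaining tips. -/

theorem four_le_egirth_iff {V : Type*} {G : SimpleGraph V} :
    ((4 : ℕ) : ℕ∞) ≤ G.egirth ↔ ∀ u v w, G.Adj u v → G.Adj v w → ¬ G.Adj u w := by
  classical
  rw [SimpleGraph.le_egirth]
  constructor
  · intro h u v w huv hvw huw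
    have h3 : G.IsNClique 3 {u, v, w} := SimpleGraph.is3Clique_triple_iff.2 ⟨huv, huw, hvw⟩
    obtain ⟨x, p, hp, hl⟩ := SimpleGraph.is3Clique_iff_exists_cycle_length_three.1 ⟨_, h3⟩
    have := h x p hp
    rw [hl] at this
    exact absurd (Nat.cast_le.1 this) (by norm_num)
  · intro h x p hp
    have h3 := hp.three_le_length
    rw [Nat.cast_le]
    by_contra hlt
    obtain ⟨s, hs⟩ := SimpleGraph.is3Clique_iff_exists_cycle_length_three.2
      ⟨x, p, hp, by omega⟩
    obtain ⟨u, v, w, huv, huw, hvw, -⟩ := SimpleGraph.is3Clique_iff.1 hs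
    exact h u v w huv hvw huw

/-- If `f` maps every element of the cycle `l` to the following one, then it maps `l` to `l`. -/
theorem mem_of_chain {α : Type*} {f : α → α} {l : List α}
    (h : Cycle.Chain (fun x y => f x = y) (l : Cycle α)) {d : α} (hd : d ∈ l) : f d ∈ l := by
  obtain ⟨s, u, rfl⟩ := List.append_of_mem hd
  -- Rotating the cycle so that `d` comes first puts its follower in second place, or back at `d`
  -- when the cycle has one element.
  have hr : ((s ++ d :: u : List α) : Cycle α) = ((d :: (u ++ s) : List α) : Cycle α) :=
    Cycle.coe_eq_coe.2 (by simpa using List.isRotated_append (l := s) (l' := d :: u))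
  rw [hr, Cycle.chain_coe_cons] at h
  rcases hw : u ++ s with _ | ⟨e, w⟩
  · rw [hw] at h
    have : f d = d := by simpa using h
    simp [this]
  · rw [hw] at h
    have h1 : f d = e := by
      rw [List.cons_append, List.isChain_cons_cons] at h
      exact h.1
    have : e ∈ u ++ s := by simp [hw]
    rw [h1]
    simp only [List.mem_append, List.mem_cons] at this ⊢
    tauto

theorem sameCycle_of_isChain {α : Type*} {f : Perm α} {a b : α} {u v : List α}
    (h : List.IsChain (fun x y => f x = y) (a :: u ++ b :: v)) : f.SameCycle a b := by
  induction u generalizing a with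
  | nil =>
    simp only [List.cons_append, List.nil_append, List.isChain_cons_cons] at h
    exact ⟨1, by simpa using h.1⟩
  | cons c u ih =>
    simp only [List.cons_append, List.isChain_cons_cons] at h
    have := ih (a := c) (by simpa using h.2)
    rw [← h.1] at this
    exact Perm.sameCycle_apply_left.1 this

/-! ### The effect of a join on half-edges, graph and boundary walks -/

namespace Position

variable {n : ℕ} {t : Fin n → ℕ}

/-- The pairing of half-edges after the tips `a` and `b` have been joined. -/
def joinOpp (P : Position t) (a b : Arm t) : Perm (Arm t) :=
  P.opp * swap a (Sum.inr (P.moves, 0)) * swap b (Sum.inr (P.moves, 2))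

/-- The pairing of half-edges is symmetric, and touches drawn arms only. -/
structure WellFormed (P : Position t) : Prop where
  opp_opp : ∀ d, P.opp (P.opp d) = d
  opp_undrawn : ∀ d, ¬ P.Drawn d → P.opp d = d

theorem not_drawn_new (P : Position t) (s : Fin 4) : ¬ P.Drawn (Sum.inr (P.moves, s)) := by
  simp [Drawn]

theorem Drawn.ne_new {P : Position t} {d : Arm t} (h : P.Drawn d) (s : Fin 4) :
    d ≠ Sum.inr (P.moves, s) := by
  rintro rfl
  exact P.not_drawn_new s h

theorem Drawn.vert_ne {P : Position t} {d : Arm t} (h : P.Drawn d) :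
    vert d ≠ Sum.inr P.moves := by
  rcases d with d | ⟨k, s⟩
  · simp [vert]
  · simp only [Drawn] at h
    simp [vert, h.ne]

theorem WellFormed.drawn_of_ne {P : Position t} (h : P.WellFormed) {d : Arm t}
    (hd : P.opp d ≠ d) : P.Drawn d := by
  by_contra hn
  exact hd (h.opp_undrawn d hn)

theorem WellFormed.drawn_opp {P : Position t} (h : P.WellFormed) {d : Arm t}
    (hd : P.Drawn d) : P.Drawn (P.opp d) := by
  by_contra hn
  have := h.opp_undrawn _ hn
  rw [h.opp_opp] at this
  exact hn (this ▸ hd)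

section joinOpp

variable {P : Position t} {a b : Arm t} (hP : P.WellFormed) (ha : P.IsTip a) (hb : P.IsTip b)
  (hab : a ≠ b)
include hP ha hb hab

theorem joinOpp_left : P.joinOpp a b a = Sum.inr (P.moves, 0) := by
  simp [joinOpp, Perm.mul_apply, swap_apply_of_ne_of_ne hab (ha.1.ne_new 2),
    hP.opp_undrawn _ (P.not_drawn_new 0)]

theorem joinOpp_right : P.joinOpp a b b = Sum.inr (P.moves, 2) := by
  rw [joinOpp, Perm.mul_apply, Perm.mul_apply, swap_apply_left,
    swap_apply_of_ne_of_ne (ha.1.ne_new 2).symm (by simp), hP.opp_undrawn _ (P.not_drawn_new 2)]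

theorem joinOpp_zero : P.joinOpp a b (Sum.inr (P.moves, 0)) = a := by
  rw [joinOpp, Perm.mul_apply, Perm.mul_apply,
    swap_apply_of_ne_of_ne (hb.1.ne_new 0).symm (by simp), swap_apply_right, ha.2]

theorem joinOpp_two : P.joinOpp a b (Sum.inr (P.moves, 2)) = b := by
  rw [joinOpp, Perm.mul_apply, Perm.mul_apply, swap_apply_right,
    swap_apply_of_ne_of_ne hab.symm (hb.1.ne_new 0), hb.2]

omit hP ha hb hab in
theorem joinOpp_other {d : Arm t} (h1 : d ≠ a) (h2 : d ≠ b) (h3 : d ≠ Sum.inr (P.moves, 0))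
    (h4 : d ≠ Sum.inr (P.moves, 2)) : P.joinOpp a b d = P.opp d := by
  rw [joinOpp, Perm.mul_apply, Perm.mul_apply, swap_apply_of_ne_of_ne h2 h4,
    swap_apply_of_ne_of_ne h1 h3]

/-- The half-edges after a join: the four halves of the two new edges, and the old half-edges. -/
theorem joinOpp_ne_iff {d : Arm t} : P.joinOpp a b d ≠ d ↔
    d = a ∨ d = b ∨ d = Sum.inr (P.moves, 0) ∨ d = Sum.inr (P.moves, 2) ∨
      (P.opp d ≠ d ∧ P.joinOpp a b d = P.opp d) := by
  by_cases h1 : d = a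
  · subst h1
    simp [joinOpp_left hP ha hb hab, (ha.1.ne_new 0).symm]
  by_cases h2 : d = b
  · subst h2
    simp [joinOpp_right hP ha hb hab, (hb.1.ne_new 2).symm]
  by_cases h3 : d = Sum.inr (P.moves, 0)
  · subst h3
    simp [joinOpp_zero hP ha hb hab, ha.1.ne_new 0]
  by_cases h4 : d = Sum.inr (P.moves, 2)
  · subst h4
    simp [joinOpp_two hP ha hb hab, hb.1.ne_new 2]
  simp [h1, h2, h3, h4, joinOpp_other h1 h2 h3 h4]

end joinOpp

theorem graph_adj {P : Position t} (hP : P.WellFormed) {v w : Vertex n} :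
    P.graph.Adj v w ↔ v ≠ w ∧ ∃ d, P.opp d ≠ d ∧ vert d = v ∧ vert (P.opp d) = w := by
  rw [graph, SimpleGraph.fromRel_adj]
  refine and_congr_right fun _ => ⟨?_, Or.inl⟩
  rintro (h | ⟨d, h1, h2, h3⟩)
  · exact h
  · exact ⟨P.opp d, by rw [hP.opp_opp]; exact h1.symm, h3, by rw [hP.opp_opp]; exact h2⟩

/-- Vertex `P.moves` is not drawn yet. After the next move its only neighbours are therefore the two
joined vertices, which yields the nonadjacencies needed in the strategies. -/
theorem not_adj_new {P : Position t} (hP : P.WellFormed) {v : Vertex n} :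
    ¬ P.graph.Adj (Sum.inr P.moves) v := by
  rw [graph_adj hP]
  rintro ⟨-, d, h1, h2, -⟩
  exact (hP.drawn_of_ne h1).vert_ne h2

theorem drawn_succ_iff {P Q : Position t} (hQ : Q.moves = P.moves + 1) {d : Arm t} :
    Q.Drawn d ↔ P.Drawn d ∨ ∃ s, d = Sum.inr (P.moves, s) := by
  rcases d with d | ⟨k, s⟩
  · simp [Drawn]
  · simp [Drawn, hQ, le_iff_lt_or_eq]

section join

variable {P Q : Position t} {a b : Arm t} (hP : P.WellFormed) (ha : P.IsTip a) (hb : P.IsTip b)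
  (hab : a ≠ b) (hm : Q.moves = P.moves + 1) (ho : Q.opp = P.joinOpp a b)
include hP ha hb hab hm ho

theorem wellFormed_join : Q.WellFormed := by
  constructor
  · intro d
    rw [ho]
    by_cases h : P.joinOpp a b d = d
    · rw [h, h]
    rcases (joinOpp_ne_iff hP ha hb hab).1 h with rfl | rfl | rfl | rfl | ⟨h1, h2⟩
    · rw [joinOpp_left hP ha hb hab, joinOpp_zero hP ha hb hab]
    · rw [joinOpp_right hP ha hb hab, joinOpp_two hP ha hb hab]
    · rw [joinOpp_zero hP ha hb hab, joinOpp_left hP ha hb hab]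
    · rw [joinOpp_two hP ha hb hab, joinOpp_right hP ha hb hab]
    · have h3 : P.Drawn (P.opp d) := hP.drawn_opp (hP.drawn_of_ne h1)
      rw [h2, joinOpp_other, hP.opp_opp]
      · intro h
        have := ha.2
        rw [← h, hP.opp_opp] at this
        exact h1 this.symm
      · intro h
        have := hb.2
        rw [← h, hP.opp_opp] at this
        exact h1 this.symm
      · exact h3.ne_new 0
      · exact h3.ne_new 2
  · intro d hd
    rw [drawn_succ_iff hm] at hd
    push Not at hd
    rw [ho, joinOpp_other _ _ (hd.2 0) (hd.2 2), hP.opp_undrawn _ hd.1]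
    · rintro rfl
      exact hd.1 ha.1
    · rintro rfl
      exact hd.1 hb.1

theorem graph_adj_join {v w : Vertex n} : Q.graph.Adj v w ↔ P.graph.Adj v w ∨
    (v = Sum.inr P.moves ∧ (w = vert a ∨ w = vert b)) ∨
    (w = Sum.inr P.moves ∧ (v = vert a ∨ v = vert b)) := by
  rw [graph_adj (wellFormed_join hP ha hb hab hm ho), graph_adj hP, ho]
  constructor
  · rintro ⟨hvw, d, h1, rfl, rfl⟩
    rcases (joinOpp_ne_iff hP ha hb hab).1 h1 with rfl | rfl | rfl | rfl | ⟨h2, h3⟩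
    · simp [joinOpp_left hP ha hb hab, vert]
    · simp [joinOpp_right hP ha hb hab, vert]
    · simp [joinOpp_zero hP ha hb hab, vert]
    · simp [joinOpp_two hP ha hb hab, vert]
    · rw [h3] at hvw ⊢
      exact Or.inl ⟨hvw, d, h2, rfl, rfl⟩
  · rintro (⟨hvw, d, h1, rfl, rfl⟩ | ⟨rfl, rfl | rfl⟩ | ⟨rfl, rfl | rfl⟩)
    · have hd : P.joinOpp a b d = P.opp d := by
        have h3 := hP.drawn_of_ne h1
        refine joinOpp_other ?_ ?_ (h3.ne_new 0) (h3.ne_new 2)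
        · rintro rfl
          exact h1 ha.2
        · rintro rfl
          exact h1 hb.2
      exact ⟨hvw, d, by rwa [hd], rfl, by rw [hd]⟩
    · exact ⟨ha.1.vert_ne.symm, Sum.inr (P.moves, 0),
        by rw [joinOpp_zero hP ha hb hab]; exact ha.1.ne_new 0, rfl,
        by rw [joinOpp_zero hP ha hb hab]⟩
    · exact ⟨hb.1.vert_ne.symm, Sum.inr (P.moves, 2),
        by rw [joinOpp_two hP ha hb hab]; exact hb.1.ne_new 2, rfl,
        by rw [joinOpp_two hP ha hb hab]⟩
    · exact ⟨ha.1.vert_ne, a,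
        by rw [joinOpp_left hP ha hb hab]; exact (ha.1.ne_new 0).symm, rfl,
        by rw [joinOpp_left hP ha hb hab]; rfl⟩
    · exact ⟨hb.1.vert_ne, b,
        by rw [joinOpp_right hP ha hb hab]; exact (hb.1.ne_new 2).symm, rfl,
        by rw [joinOpp_right hP ha hb hab]; rfl⟩

/-- Joining two tips at distinct nonadjacent vertices creates no cycle of length less than 4. -/
theorem girthAtLeast_join (hg : P.GirthAtLeast 4) (hv : vert a ≠ vert b)
    (hadj : ¬ P.graph.Adj (vert a) (vert b)) : Q.GirthAtLeast 4 := by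
  have hva := ha.1.vert_ne
  have hvb := hb.1.vert_ne
  have ea := joinOpp_left hP ha hb hab
  have eb := joinOpp_right hP ha hb hab
  have e0 := joinOpp_zero hP ha hb hab
  have e2 := joinOpp_two hP ha hb hab
  refine ⟨?_, ?_, ?_⟩
  · intro d hd
    rw [ho] at hd ⊢
    rcases (joinOpp_ne_iff hP ha hb hab).1 hd with rfl | rfl | rfl | rfl | ⟨h2, h3⟩
    · rw [ea]; exact hva.symm
    · rw [eb]; exact hvb.symm
    · rw [e0]; exact hva
    · rw [e2]; exact hvb
    · rw [h3]; exact hg.no_loop d h2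
  · intro d e hd he
    rw [ho] at hd he ⊢
    -- Old edges avoid the new vertex at both ends, so a parallel pair would have to be two old
    -- edges or two new ones; the new ones differ because `vert a ≠ vert b`.
    have old : ∀ x, P.opp x ≠ x → vert x ≠ Sum.inr P.moves ∧ vert (P.opp x) ≠ Sum.inr P.moves :=
      fun x hx => ⟨(hP.drawn_of_ne hx).vert_ne, (hP.drawn_opp (hP.drawn_of_ne hx)).vert_ne⟩
    have n0 : vert (Sum.inr (P.moves, 0) : Arm t) = Sum.inr P.moves := rfl
    have n2 : vert (Sum.inr (P.moves, 2) : Arm t) = Sum.inr P.moves := rfl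
    rcases (joinOpp_ne_iff hP ha hb hab).1 hd with hd | hd | hd | hd | ⟨h2, h3⟩ <;>
    rcases (joinOpp_ne_iff hP ha hb hab).1 he with he | he | he | he | ⟨h4, h5⟩
    all_goals first
      | (rw [hd, he]; simp only [ea, eb, e0, e2, n0, n2]; intro h h'; grind)
      | (rw [hd, h5]; simp only [ea, eb, e0, e2, n0, n2]; have := old e h4; intro h h'; grind)
      | (rw [he, h3]; simp only [ea, eb, e0, e2, n0, n2]; have := old d h2; intro h h'; grind)
      | (rw [h3, h5]; exact hg.no_parallel d e h2 h4)
  · rw [four_le_egirth_iff]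
    have hg' := four_le_egirth_iff.1 hg.girth
    have nn : ∀ v, ¬ P.graph.Adj (Sum.inr P.moves) v := fun v => not_adj_new hP
    have nn' : ∀ v, ¬ P.graph.Adj v (Sum.inr P.moves) := fun v h => nn v h.symm
    have hadj' : ¬ P.graph.Adj (vert b) (vert a) := fun h => hadj h.symm
    have irr : ∀ v, ¬ P.graph.Adj v v := fun v => P.graph.irrefl
    intro u v w
    simp only [graph_adj_join hP ha hb hab hm ho]
    grind

/-- If the two vertices coincide, the new edges are parallel; if they are adjacent, they form a
triangle with the new vertex. -/
theorem nonadj_of_girthAtLeast_join (hg : Q.GirthAtLeast 4) :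
    vert a ≠ vert b ∧ ¬ P.graph.Adj (vert a) (vert b) := by
  constructor
  · intro h
    refine hab (hg.no_parallel a b ?_ ?_ h ?_)
    · rw [ho, joinOpp_left hP ha hb hab]; exact (ha.1.ne_new 0).symm
    · rw [ho, joinOpp_right hP ha hb hab]; exact (hb.1.ne_new 2).symm
    · rw [ho, joinOpp_left hP ha hb hab, joinOpp_right hP ha hb hab]; rfl
  · intro h
    refine four_le_egirth_iff.1 hg.girth (vert a) (Sum.inr P.moves) (vert b) ?_ ?_ ?_ <;>
    rw [graph_adj_join hP ha hb hab hm ho] <;> tauto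

-- The walk now runs from `a` through arms 1 and 2 to the old follower of `b`, and from `b` through
-- arms 3 and 0 to the old follower of `a`. This exchange of followers splits a common cycle and
-- merges two different ones.
omit hm in
theorem boundaryStep_join :
    Q.boundaryStep a = Sum.inr (P.moves, 1) ∧
    Q.boundaryStep (Sum.inr (P.moves, 1)) = Sum.inr (P.moves, 2) ∧
    Q.boundaryStep (Sum.inr (P.moves, 2)) = P.boundaryStep b ∧
    Q.boundaryStep b = Sum.inr (P.moves, 3) ∧
    Q.boundaryStep (Sum.inr (P.moves, 3)) = Sum.inr (P.moves, 0) ∧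
    Q.boundaryStep (Sum.inr (P.moves, 0)) = P.boundaryStep a := by
  have o1 : P.joinOpp a b (Sum.inr (P.moves, 1)) = Sum.inr (P.moves, 1) := by
    rw [joinOpp_other (ha.1.ne_new 1).symm (hb.1.ne_new 1).symm (by simp) (by simp),
      hP.opp_undrawn _ (P.not_drawn_new 1)]
  have o3 : P.joinOpp a b (Sum.inr (P.moves, 3)) = Sum.inr (P.moves, 3) := by
    rw [joinOpp_other (ha.1.ne_new 3).symm (hb.1.ne_new 3).symm (by simp) (by simp),
      hP.opp_undrawn _ (P.not_drawn_new 3)]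
  simp only [boundaryStep, Perm.mul_apply, ho, joinOpp_left hP ha hb hab, o1, o3,
    joinOpp_right hP ha hb hab, joinOpp_zero hP ha hb hab, joinOpp_two hP ha hb hab, ha.2, hb.2]
  simp [next]

omit hm hP ha hb hab in
theorem boundaryStep_join_other {d : Arm t} (h1 : d ≠ a) (h2 : d ≠ b)
    (h3 : d ≠ Sum.inr (P.moves, 0)) (h4 : d ≠ Sum.inr (P.moves, 2)) :
    Q.boundaryStep d = P.boundaryStep d := by
  simp only [boundaryStep, Perm.mul_apply, ho, joinOpp_other h1 h2 h3 h4]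

end join

end Position

end BrusselsSprout

/-! ### Positions in which each face has a single boundary cycle -/

namespace BrusselsSprout

open Equiv

namespace Position

variable {n : ℕ} {t : Fin n → ℕ}

/-- `F` lists the boundary cycles of the position `P`, and every face has just one of them. -/
structure Boundaries (P : Position t) (F : List (List (Arm t))) : Prop extends
    P.WellFormed where
  girth : P.GirthAtLeast 4
  face_le : ∀ d, P.Drawn d → P.face d ≤ P.moves
  nodup : F.flatten.Nodup
  drawn_iff : ∀ d, P.Drawn d ↔ d ∈ F.flatten
  chain : ∀ l ∈ F, Cycle.Chain (fun x y => P.boundaryStep x = y) (l : Cycle (Arm t))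
  face_iff : ∀ l ∈ F, ∀ d ∈ l, ∀ e, P.Drawn e → (P.face e = P.face d ↔ e ∈ l)

theorem Boundaries.perm {P : Position t} {F F' : List (List (Arm t))} (h : P.Boundaries F)
    (hF : F.Perm F') : P.Boundaries F' where
  toWellFormed := h.toWellFormed
  girth := h.girth
  face_le := h.face_le
  nodup := hF.flatten.nodup_iff.1 h.nodup
  drawn_iff d := (h.drawn_iff d).trans hF.flatten.mem_iff
  chain l hl := h.chain l (hF.mem_iff.2 hl)
  face_iff l hl := h.face_iff l (hF.mem_iff.2 hl)

theorem Boundaries.rotate {P : Position t} {F : List (List (Arm t))} {l m : List (Arm t)}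
    (h : P.Boundaries ((l ++ m) :: F)) : P.Boundaries ((m ++ l) :: F) where
  toWellFormed := h.toWellFormed
  girth := h.girth
  face_le := h.face_le
  nodup := by
    have := h.nodup
    rw [List.flatten_cons] at this ⊢
    exact (List.Perm.append_right _ List.perm_append_comm).nodup_iff.1 this
  drawn_iff d := by
    rw [h.drawn_iff d]
    simp only [List.flatten_cons, List.mem_append]
    tauto
  chain k hk := by
    rcases List.mem_cons.1 hk with rfl | hk
    · rw [show ((m ++ l : List (Arm t)) : Cycle (Arm t)) = ((l ++ m : List (Arm t)) : Cycle _) from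
        Cycle.coe_eq_coe.2 List.isRotated_append]
      exact h.chain _ List.mem_cons_self
    · exact h.chain k (List.mem_cons_of_mem _ hk)
  face_iff k hk d hd e he := by
    rcases List.mem_cons.1 hk with rfl | hk
    · rw [h.face_iff (l ++ m) List.mem_cons_self d (by simpa [or_comm] using hd) e he]
      simp [or_comm]
    · exact h.face_iff k (List.mem_cons_of_mem _ hk) d hd e he

theorem Boundaries.face_boundaryStep {P : Position t} {F : List (List (Arm t))}
    (h : P.Boundaries F) {d : Arm t} (hd : P.Drawn d) :
    P.face (P.boundaryStep d) = P.face d := by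
  obtain ⟨l, hl, hdl⟩ := List.mem_flatten.1 ((h.drawn_iff d).1 hd)
  have hm := mem_of_chain (h.chain l hl) hdl
  exact (h.face_iff l hl d hdl _ ((h.drawn_iff _).2 (List.mem_flatten.2 ⟨l, hl, hm⟩))).2 hm

theorem isChain_congr {α : Type*} {f g : α → α} {l : List α} {x : α}
    (h : List.IsChain (fun x y => f x = y) (l ++ [x])) (hfg : ∀ d ∈ l, g d = f d) :
    List.IsChain (fun x y => g x = y) (l ++ [x]) := by
  induction l with
  | nil => simp
  | cons c l ih =>
    rcases l with _ | ⟨e, l⟩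
    · have := hfg c (by simp)
      simp only [List.cons_append, List.nil_append, List.isChain_cons_cons] at h ⊢
      exact ⟨this.trans h.1, by simp⟩
    · simp only [List.cons_append, List.isChain_cons_cons] at h ⊢
      exact ⟨(hfg c (by simp)).trans h.1,
        by simpa using ih (by simpa using h.2) fun d hd => hfg d (by simp [hd])⟩

theorem chain_congr {α : Type*} {f g : α → α} {l : List α}
    (h : Cycle.Chain (fun x y => f x = y) (l : Cycle α)) (hfg : ∀ d ∈ l, g d = f d) :
    Cycle.Chain (fun x y => g x = y) (l : Cycle α) := by
  rcases l with _ | ⟨c, l⟩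
  · simp
  · rw [Cycle.chain_coe_cons] at h ⊢
    rw [← List.cons_append] at h ⊢
    exact isChain_congr h hfg

/-- The first step of a chain may be replaced by any list with the same follower. -/
theorem isChain_cons_replace {α : Type*} {f g : α → α} {a c x : α} {l : List α}
    (h : List.IsChain (fun x y => f x = y) (a :: l ++ [x])) (hc : g c = f a)
    (hfg : ∀ d ∈ l, g d = f d) : List.IsChain (fun x y => g x = y) (c :: l ++ [x]) := by
  rcases l with _ | ⟨e, l⟩
  · simp only [List.cons_append, List.nil_append, List.isChain_cons_cons] at h ⊢
    exact ⟨hc.trans h.1, by simp⟩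
  · have h2 : List.IsChain (fun x y => f x = y) ((e :: l) ++ [x]) := by
      simp only [List.cons_append, List.isChain_cons_cons] at h ⊢
      exact h.2
    have := isChain_congr h2 hfg
    simp only [List.cons_append, List.isChain_cons_cons] at h this ⊢
    exact ⟨hc.trans h.1, this⟩

/-- Joining two tips `a`, `b` on one boundary cycle `a :: u ++ b :: v` splits it. -/
theorem Boundaries.exists_join {P : Position t} {F : List (List (Arm t))} {a b : Arm t}
    {u v : List (Arm t)} (h : P.Boundaries ((a :: u ++ b :: v) :: F))
    (ha : P.opp a = a) (hb : P.opp b = b) (hv : vert a ≠ vert b)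
    (hadj : ¬ P.graph.Adj (vert a) (vert b)) :
    ∃ Q : Position t, P.Join Q a b ∧ Q.Boundaries
      ((b :: Sum.inr (P.moves, 3) :: Sum.inr (P.moves, 0) :: u) ::
        (a :: Sum.inr (P.moves, 1) :: Sum.inr (P.moves, 2) :: v) :: F) := by
  classical
  have had : P.Drawn a := (h.drawn_iff a).2 (by simp)
  have hbd : P.Drawn b := (h.drawn_iff b).2 (by simp)
  have hab : a ≠ b := fun e => hv (congrArg vert e)
  set L : List (Arm t) := b :: Sum.inr (P.moves, 3) :: Sum.inr (P.moves, 0) :: u with hL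
  set M : List (Arm t) := a :: Sum.inr (P.moves, 1) :: Sum.inr (P.moves, 2) :: v with hM
  -- The cycle through `b` gets the new face name, fresh because `face_le` bounds all old names by
  -- `P.moves`; the cycle through `a` keeps the old one.
  let Q : Position t := ⟨P.moves + 1, P.joinOpp a b, fun d =>
    if d ∈ L then P.moves + 1 else if d ∈ M then P.face a else P.face d⟩
  have ho : Q.opp = P.joinOpp a b := rfl
  have hm : Q.moves = P.moves + 1 := rfl
  have hta : P.IsTip a := ⟨had, ha⟩
  have htb : P.IsTip b := ⟨hbd, hb⟩
  have fresh : ∀ s, (Sum.inr (P.moves, s) : Arm t) ∉ (((a :: u ++ b :: v) :: F).flatten) :=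
    fun s hs => P.not_drawn_new s ((h.drawn_iff _).2 hs)
  have hdis := h.nodup
  have hnd : (L :: M :: F).flatten.Nodup := by
    simp only [List.flatten_cons, List.cons_append, List.mem_append, List.mem_cons,
      List.append_assoc] at fresh
    have f0 := fresh 0
    have f1 := fresh 1
    have f2 := fresh 2
    have f3 := fresh 3
    simp only [hL, hM, List.flatten_cons, List.cons_append, List.nodup_cons, List.mem_append,
      List.mem_cons, List.append_assoc, List.nodup_append, Sum.inr.injEq, Prod.mk.injEq,
      true_and, not_or] at hdis f0 f1 f2 f3 ⊢
    grind
  have hmem : ∀ d, Q.Drawn d ↔ d ∈ (L :: M :: F).flatten := by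
    intro d
    rw [drawn_succ_iff hm, h.drawn_iff]
    simp only [hL, hM, List.flatten_cons, List.cons_append, List.mem_append, List.mem_cons]
    constructor
    · rintro (h | ⟨s, rfl⟩)
      · tauto
      · fin_cases s <;> simp
    · rintro ((rfl | rfl | rfl | h) | (rfl | rfl | rfl | h) | h) <;>
        first | exact Or.inr ⟨_, rfl⟩ | tauto
  have hLM : ∀ d ∈ L, d ∉ M := by
    intro d h1 h2
    simp only [List.flatten_cons, List.nodup_append] at hnd
    exact hnd.2.2 d h1 d (by simp [h2]) rfl
  have hLF : ∀ d ∈ L, d ∉ F.flatten := by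
    intro d h1 h2
    simp only [List.flatten_cons, List.nodup_append] at hnd
    exact hnd.2.2 d h1 d (List.mem_append_right _ h2) rfl
  have hMF : ∀ d ∈ M, d ∉ F.flatten := by
    intro d h1 h2
    simp only [List.flatten_cons, List.nodup_append] at hnd
    exact hnd.2.1.2.2 d h1 d h2 rfl
  have faceL : ∀ d ∈ L, Q.face d = P.moves + 1 := fun d hd => if_pos hd
  have faceM : ∀ d ∈ M, Q.face d = P.face a := fun d hd =>
    (if_neg fun h' => hLM d h' hd).trans (if_pos hd)
  have faceF : ∀ d ∈ F.flatten, Q.face d = P.face d := fun d hd =>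
    (if_neg fun h' => hLF d h' hd).trans (if_neg fun h' => hMF d h' hd)
  have drawnF : ∀ d ∈ F.flatten, P.Drawn d := fun d hd => (h.drawn_iff d).2 (by simp [-List.mem_flatten, hd])
  have oldF : ∀ d ∈ F.flatten, P.face d ≠ P.face a := by
    intro d hd he
    have := (h.face_iff _ List.mem_cons_self a (by simp) d (drawnF d hd)).1 he
    rw [List.flatten_cons, List.nodup_append] at hdis
    exact hdis.2.2 d this d hd rfl
  obtain ⟨sa, s1, s2, sb, s3, s0⟩ := boundaryStep_join h.toWellFormed hta htb hab ho
  have hB : Q.Boundaries (L :: M :: F) :=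
    { toWellFormed := wellFormed_join h.toWellFormed hta htb hab hm ho
      girth := girthAtLeast_join h.toWellFormed hta htb hab hm ho h.girth hv hadj
      face_le := by
        intro d hd
        rw [hmem] at hd
        simp only [List.flatten_cons, List.mem_append] at hd
        rcases hd with hd | hd | hd
        · rw [faceL d hd, hm]
        · rw [faceM d hd, hm]
          exact (h.face_le a had).trans (Nat.le_succ _)
        · rw [faceF d hd, hm]
          exact (h.face_le d (drawnF d hd)).trans (Nat.le_succ _)
      nodup := hnd
      drawn_iff := hmem
      chain := by
        have hc := h.chain _ List.mem_cons_self
        rw [List.cons_append, Cycle.chain_coe_cons] at hc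
        have hc1 : List.IsChain (fun x y => P.boundaryStep x = y) (a :: u ++ [b]) := by
          refine hc.prefix ⟨v ++ [a], by simp⟩
        have hc2 : List.IsChain (fun x y => P.boundaryStep x = y) (b :: v ++ [a]) := by
          refine hc.suffix ⟨a :: u, by simp⟩
        have other : ∀ d ∈ u ++ v, Q.boundaryStep d = P.boundaryStep d := by
          intro d hd
          have hdm : d ∈ ((a :: u ++ b :: v) :: F).flatten := by
            simp only [List.mem_append] at hd
            simp only [List.flatten_cons, List.mem_append, List.mem_cons]
            tauto
          refine boundaryStep_join_other ho ?_ ?_ ?_ ?_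
          · rintro rfl
            simp [List.nodup_append] at hdis hd
            tauto
          · rintro rfl
            simp [List.nodup_append] at hdis hd
            grind
          · rintro rfl
            exact fresh _ hdm
          · rintro rfl
            exact fresh _ hdm
        intro l hl
        simp only [List.mem_cons] at hl
        rcases hl with rfl | rfl | hl
        · rw [hL, Cycle.chain_coe_cons]
          simp only [List.cons_append, List.isChain_cons_cons]
          exact ⟨sb, s3, isChain_cons_replace hc1 s0 fun d hd => other d (by simp [hd])⟩
        · rw [hM, Cycle.chain_coe_cons]
          simp only [List.cons_append, List.isChain_cons_cons]
          exact ⟨sa, s1, isChain_cons_replace hc2 s2 fun d hd => other d (by simp [hd])⟩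
        · refine chain_congr (h.chain l (List.mem_cons_of_mem _ hl)) fun d hd => ?_
          have hdF : d ∈ F.flatten := List.mem_flatten.2 ⟨l, hl, hd⟩
          refine boundaryStep_join_other ho ?_ ?_ ?_ ?_
          · rintro rfl
            exact hMF _ (by simp [hM]) hdF
          · rintro rfl
            exact hLF _ (by simp [hL]) hdF
          · rintro rfl
            exact hLF _ (by simp [hL]) hdF
          · rintro rfl
            exact hMF _ (by simp [hM]) hdF
      face_iff := by
        have cases3 : ∀ e, Q.Drawn e → e ∈ L ∨ e ∈ M ∨ e ∈ F.flatten := by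
          intro e he
          rw [hmem] at he
          simpa only [List.flatten_cons, List.mem_append] using he
        intro l hl d hd e he
        simp only [List.mem_cons] at hl
        have ha' := h.face_le a had
        rcases hl with rfl | rfl | hl
        · rw [faceL d hd]
          rcases cases3 e he with h1 | h1 | h1
          · simp [faceL e h1, h1]
          · rw [faceM e h1]
            exact iff_of_false (by omega) fun h2 => hLM e h2 h1
          · rw [faceF e h1]
            have := h.face_le e (drawnF e h1)
            exact iff_of_false (by omega) fun h2 => hLF e h2 h1
        · rw [faceM d hd]
          rcases cases3 e he with h1 | h1 | h1
          · rw [faceL e h1]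
            exact iff_of_false (by omega) fun h2 => hLM e h1 h2
          · simp [faceM e h1, h1]
          · rw [faceF e h1]
            exact iff_of_false (oldF e h1) fun h2 => hMF e h2 h1
        · have hdF : d ∈ F.flatten := List.mem_flatten.2 ⟨l, hl, hd⟩
          have := h.face_le d (drawnF d hdF)
          rw [faceF d hdF]
          rcases cases3 e he with h1 | h1 | h1
          · rw [faceL e h1]
            exact iff_of_false (by omega) fun h2 => hLF e h1 (List.mem_flatten.2 ⟨l, hl, h2⟩)
          · rw [faceM e h1]
            exact iff_of_false (oldF d hdF).symm
              fun h2 => hMF e h1 (List.mem_flatten.2 ⟨l, hl, h2⟩)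
          · rw [faceF e h1]
            exact h.face_iff l (List.mem_cons_of_mem _ hl) d hd e (drawnF e h1) }
  have hfab : P.face b = P.face a :=
    (h.face_iff _ List.mem_cons_self a (by simp) b hbd).2 (by simp)
  have hsame : P.boundaryStep.SameCycle a b := by
    have hc := h.chain _ List.mem_cons_self
    rw [List.cons_append, Cycle.chain_coe_cons] at hc
    exact sameCycle_of_isChain (hc.prefix (l₁ := a :: u ++ b :: v) ⟨[a], by simp⟩)
  refine ⟨Q, ⟨hta, htb, hab, hfab.symm, hm, rfl, ?_, ?_, ?_⟩, hB⟩
  · intro d hd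
    have hcase := (h.drawn_iff d).1 hd
    rw [List.flatten_cons, List.mem_append] at hcase
    rcases hcase with h1 | h1
    · have hfd : P.face d = P.face a :=
        (h.face_iff _ List.mem_cons_self a (by simp) d hd).2 h1
      by_cases h2 : d ∈ L
      · exact Or.inr ⟨hsame, hfd, faceL d h2⟩
      · left
        have h3 : d ∈ M := by
          simp only [hL, hM, List.mem_cons, List.mem_append] at h1 h2 ⊢
          tauto
        rw [faceM d h3, hfd]
    · exact Or.inl (faceF d h1)
  · intro _
    rw [faceM a (by simp [hM]), faceL b (by simp [hL])]
    have := h.face_le a had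
    omega
  · intro d hd
    exact hB.face_boundaryStep hd

end Position

end BrusselsSprout

/-! ### Cyclic words of faces, and the moves expressed by them -/

namespace BrusselsSprout

open Equiv
open scoped List

/-- The list 0, 1, ..., m - 1 closes up under rotation, so the tips of an isolated spot form one
boundary cycle. -/
theorem exists_finRotate_chain {m : ℕ} (hm : 0 < m) : ∃ (a : Fin m) (l : List (Fin m)),
    (a :: l).Nodup ∧ (∀ x, x ∈ a :: l) ∧ l.length = m - 1 ∧
      List.IsChain (fun x y => finRotate m x = y) (a :: l ++ [a]) := by
  obtain ⟨m, rfl⟩ := Nat.exists_eq_succ_of_ne_zero hm.ne'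
  have h : (0 : Fin (m + 1)) :: (List.finRange m).map Fin.succ = List.finRange (m + 1) :=
    List.finRange_succ.symm
  refine ⟨0, (List.finRange m).map Fin.succ, ?_, ?_, by simp, ?_⟩
  · rw [h]
    exact List.nodup_finRange _
  · intro x
    rw [h]
    exact List.mem_finRange x
  · rw [h, List.isChain_iff_getElem]
    intro i hi
    simp only [List.length_append, List.length_finRange, List.length_singleton] at hi
    rw [List.getElem_append_left (by simp; omega)]
    by_cases h1 : i < m
    · rw [List.getElem_append_left (by simp; omega)]
      ext
      rw [coe_finRotate_of_ne_last]
      · simp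
      · intro h2
        have := congrArg Fin.val h2
        simp at this
        omega
    · have : i = m := by omega
      subst this
      rw [List.getElem_append_right (by simp)]
      simp only [List.length_finRange, List.getElem_finRange, List.getElem_singleton]
      exact finRotate_last

namespace Position

variable {n : ℕ} {t : Fin n → ℕ}

/-- The vertices of the open tips in a list of arms. -/
def word (P : Position t) (l : List (Arm t)) : List (Vertex n) :=
  (l.filter fun d => P.opp d = d).map vert

@[simp] theorem word_nil (P : Position t) : P.word [] = [] := rfl

theorem word_append (P : Position t) (l m : List (Arm t)) :
    P.word (l ++ m) = P.word l ++ P.word m := by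
  simp [word]

theorem word_cons_of_tip {P : Position t} {d : Arm t} (h : P.opp d = d) (l : List (Arm t)) :
    P.word (d :: l) = vert d :: P.word l := by
  simp [word, h]

theorem word_cons_of_ne {P : Position t} {d : Arm t} (h : P.opp d ≠ d) (l : List (Arm t)) :
    P.word (d :: l) = P.word l := by
  simp [word, h]

/-- Lifts a chosen letter of a word back to an open tip on the boundary cycle; the half-edges around
it leave no trace in the word. -/
theorem word_eq_append_cons {P : Position t} {l : List (Arm t)} {x : Vertex n}
    {w₀ w : List (Vertex n)} (h : P.word l = w₀ ++ x :: w) : ∃ l₀ a r, l = l₀ ++ a :: r ∧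
      P.word l₀ = w₀ ∧ P.opp a = a ∧ vert a = x ∧ P.word r = w := by
  rw [word, List.map_eq_append_iff] at h
  obtain ⟨f₀, f, hf, rfl, h2⟩ := h
  rw [List.map_eq_cons_iff] at h2
  obtain ⟨a, g, rfl, rfl, rfl⟩ := h2
  obtain ⟨l₁, l₂, rfl, rfl, h3⟩ := List.filter_eq_append_iff.1 hf
  obtain ⟨l₃, l₄, rfl, h4, h5, rfl⟩ := List.filter_eq_cons_iff.1 h3
  refine ⟨l₁ ++ l₃, a, l₄, by simp, ?_, by simpa using h5, rfl, rfl⟩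
  have : l₃.filter (fun d => decide (P.opp d = d)) = [] :=
    List.filter_eq_nil_iff.2 h4
  simp [word, this]

theorem word_congr {P Q : Position t} {l : List (Arm t)} (h : ∀ d ∈ l, Q.opp d = P.opp d) :
    Q.word l = P.word l := by
  rw [word, word, List.filter_congr fun d hd => by rw [h d hd]]

theorem mem_word {P : Position t} {l : List (Arm t)} {d : Arm t} (hd : d ∈ l)
    (h : P.opp d = d) : vert d ∈ P.word l :=
  List.mem_map_of_mem (List.mem_filter.2 ⟨hd, by simpa using h⟩)

/-- No two tips with vertices in `w` can be joined. -/
def Settled (P : Position t) (w : List (Vertex n)) : Prop :=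
  ∀ x ∈ w, ∀ y ∈ w, x = y ∨ P.graph.Adj x y

/-- The faces of `P` whose tips are not known to be settled have the cyclic words `ws`. -/
def Stage (P : Position t) (ws : List (List (Vertex n))) : Prop :=
  ∃ L M, P.Boundaries (L ++ M) ∧ L.map P.word = ws ∧ ∀ m ∈ M, P.Settled (P.word m)

theorem Stage.perm {P : Position t} {ws ws' : List (List (Vertex n))} (h : P.Stage ws)
    (hw : ws.Perm ws') : P.Stage ws' := by
  obtain ⟨L, M, hB, rfl, hM⟩ := h
  -- A permutation of the words lifts to one of the boundary cycles.
  obtain ⟨L', rfl, hL⟩ : Relation.Comp (· = List.map P.word ·) (· ~ ·) ws' L := by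
    rw [List.eq_map_comp_perm]
    exact hw.symm
  exact ⟨L', M, hB.perm (hL.symm.append_right M), rfl, hM⟩

theorem Stage.settle {P : Position t} {w : List (Vertex n)} {ws : List (List (Vertex n))}
    (h : P.Stage (w :: ws)) (hw : P.Settled w) : P.Stage ws := by
  obtain ⟨L, M, hB, hL, hM⟩ := h
  obtain ⟨l, L, rfl, rfl, rfl⟩ := List.map_eq_cons_iff.1 hL
  refine ⟨L, l :: M, hB.perm ?_, rfl, ?_⟩
  · simpa using List.perm_middle.symm
  · simpa using ⟨hw, hM⟩

/-- Two tips in one face lie on one settled cycle, so their vertices are equal or adjacent, and the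
girth condition excludes both. -/
theorem Stage.not_move {P : Position t} (h : P.Stage []) (Q : Position t) : ¬ P.Move 4 Q := by
  obtain ⟨L, M, hB, hL, hM⟩ := h
  obtain rfl := List.map_eq_nil_iff.1 hL
  rintro ⟨⟨a, b, hJ⟩, hg⟩
  obtain ⟨h1, h2⟩ := nonadj_of_girthAtLeast_join hB.toWellFormed hJ.tip_left hJ.tip_right hJ.ne
    hJ.moves_eq hJ.opp_eq hg
  obtain ⟨m, hm, ham⟩ := List.mem_flatten.1 ((hB.drawn_iff a).1 hJ.tip_left.1)
  have hbm := (hB.face_iff m hm a ham b hJ.tip_right.1).1 hJ.same_face.symm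
  rcases hM m hm _ (mem_word ham hJ.tip_left.2) _ (mem_word hbm hJ.tip_right.2) with h | h
  · exact h1 h
  · exact h2 h

theorem Stage.wellFormed {P : Position t} {ws : List (List (Vertex n))} (h : P.Stage ws) :
    P.WellFormed := by
  obtain ⟨L, M, hB, -⟩ := h
  exact hB.toWellFormed

/-- Serves to tell the crossings in a word from those created later. -/
theorem Stage.lt_moves {P : Position t} {ws : List (List (Vertex n))} (h : P.Stage ws)
    {w : List (Vertex n)} (hw : w ∈ ws) {k : ℕ} (hk : Sum.inr k ∈ w) : k < P.moves := by
  obtain ⟨L, M, hB, rfl, -⟩ := h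
  obtain ⟨l, hl, rfl⟩ := List.mem_map.1 hw
  obtain ⟨d, hd, hdk⟩ := List.mem_map.1 hk
  have := (hB.drawn_iff d).2 (List.mem_flatten.2
    ⟨l, List.mem_append_left _ hl, (List.mem_filter.1 hd).1⟩)
  rcases d with d | ⟨k', s⟩
  · simp [vert] at hdk
  · obtain rfl : k' = k := by simpa [vert] using hdk
    exact this

/-- The move that joins two tips at distinct nonadjacent vertices `x`, `y` in one face. -/
theorem Stage.exists_move {P : Position t} {w₀ u v : List (Vertex n)} {x y : Vertex n}
    {ws : List (List (Vertex n))} (h : P.Stage ((w₀ ++ x :: (u ++ y :: v)) :: ws)) (hxy : x ≠ y)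
    (hadj : ¬ P.graph.Adj x y) : ∃ Q : Position t, P.Move 4 Q ∧ Q.moves = P.moves + 1 ∧
      Q.Stage ((Sum.inr P.moves :: u) :: (Sum.inr P.moves :: (v ++ w₀)) :: ws) ∧
      ∀ v w, Q.graph.Adj v w ↔ P.graph.Adj v w ∨
        (v = Sum.inr P.moves ∧ (w = x ∨ w = y)) ∨ (w = Sum.inr P.moves ∧ (v = x ∨ v = y)) := by
  obtain ⟨L, M, hB, hL, hM⟩ := h
  obtain ⟨l, L, rfl, hl, rfl⟩ := List.map_eq_cons_iff.1 hL
  obtain ⟨l₀, a, r, rfl, rfl, ha, rfl, hr⟩ := word_eq_append_cons hl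
  obtain ⟨r₀, b, r₁, rfl, rfl, hb, rfl, rfl⟩ := word_eq_append_cons hr
  -- Rotated to begin at `a`, which is why `w₀` ends up behind `v` in the resulting word.
  have hB' : P.Boundaries ((a :: r₀ ++ b :: (r₁ ++ l₀)) :: (L ++ M)) := by
    have := Boundaries.rotate (l := l₀) (m := a :: (r₀ ++ b :: r₁)) hB
    simpa using this
  obtain ⟨Q, hJ, hQ⟩ := hB'.exists_join ha hb hxy hadj
  have hPw := hB.toWellFormed
  have hta := hJ.tip_left
  have htb := hJ.tip_right
  have ho : Q.opp = P.joinOpp a b := hJ.opp_eq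
  have hadj' := fun v w =>
    graph_adj_join hPw hta htb hJ.ne hJ.moves_eq ho (v := v) (w := w)
  refine ⟨Q, ⟨⟨a, b, hJ⟩, hQ.girth⟩, hJ.moves_eq, ?_, hadj'⟩
  have hnd := hQ.nodup
  have other : ∀ d ∈ r₀ ++ (r₁ ++ l₀) ++ (L ++ M).flatten, Q.opp d = P.opp d := by
    intro d hd
    rw [ho]
    simp only [List.flatten_cons, List.cons_append, List.nodup_cons, List.mem_append,
      List.mem_cons, List.append_assoc, List.nodup_append] at hnd hd
    apply joinOpp_other <;> rintro rfl <;> grind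
  have tip : ∀ s, s ≠ 0 → s ≠ 2 → Q.opp (Sum.inr (P.moves, s)) = Sum.inr (P.moves, s) := by
    intro s h0 h2
    rw [ho, joinOpp_other (hta.1.ne_new s).symm (htb.1.ne_new s).symm (by simpa using h0)
      (by simpa using h2), hPw.opp_undrawn _ (P.not_drawn_new s)]
  have na : Q.opp a ≠ a := by
    rw [ho, joinOpp_left hPw hta htb hJ.ne]
    exact (hta.1.ne_new 0).symm
  have nb : Q.opp b ≠ b := by
    rw [ho, joinOpp_right hPw hta htb hJ.ne]
    exact (htb.1.ne_new 2).symm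
  have n0 : Q.opp (Sum.inr (P.moves, 0)) ≠ Sum.inr (P.moves, 0) := by
    rw [ho, joinOpp_zero hPw hta htb hJ.ne]
    exact hta.1.ne_new 0
  have n2 : Q.opp (Sum.inr (P.moves, 2)) ≠ Sum.inr (P.moves, 2) := by
    rw [ho, joinOpp_two hPw hta htb hJ.ne]
    exact htb.1.ne_new 2
  have hold : ∀ m ∈ L ++ M, Q.word m = P.word m := fun m hm =>
    word_congr fun d hd => other d (List.mem_append_right _ (List.mem_flatten.2 ⟨m, hm, hd⟩))
  refine ⟨(b :: Sum.inr (P.moves, 3) :: Sum.inr (P.moves, 0) :: r₀) ::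
    (a :: Sum.inr (P.moves, 1) :: Sum.inr (P.moves, 2) :: (r₁ ++ l₀)) :: L, M, by simpa using hQ,
    ?_, ?_⟩
  · rw [List.map_cons, List.map_cons, List.map_congr_left fun m hm => hold m (by simp [hm]),
      word_cons_of_ne nb, word_cons_of_tip (tip 3 (by decide) (by decide)), word_cons_of_ne n0,
      word_cons_of_ne na, word_cons_of_tip (tip 1 (by decide) (by decide)), word_cons_of_ne n2,
      word_congr (P := P) (l := r₀) fun d hd => other d (by simp [hd]),
      word_congr (P := P) (l := r₁ ++ l₀) fun d hd => other d (by
        simp only [List.mem_append] at hd ⊢; tauto), word_append]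
    rfl
  · intro m hm
    -- Settled faces keep their words, and adjacency only grows.
    rw [hold m (by simp [hm])]
    intro x hx y hy
    rw [hadj']
    exact (hM m hm x hx y hy).imp_right Or.inl

/-- The first move joins the two spots. -/
theorem exists_first_move {t : Fin 2 → ℕ} (h0 : 0 < t 0) (h1 : 0 < t 1) : ∃ Q : Position t,
    (initial t).Move 4 Q ∧ Q.moves = 1 ∧
      Q.Stage [Sum.inr 0 :: (List.replicate (t 1 - 1) (Sum.inl 1) ++
        Sum.inr 0 :: List.replicate (t 0 - 1) (Sum.inl 0))] ∧
      ¬ Q.graph.Adj (Sum.inl 0) (Sum.inl 1) := by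
  obtain ⟨a', u', hu1, hu2, hu3, hu4⟩ := exists_finRotate_chain h0
  obtain ⟨b', v', hv1, hv2, hv3, hv4⟩ := exists_finRotate_chain h1
  let f : ∀ i : Fin 2, Fin (t i) → Arm t := fun i j => Sum.inl ⟨i, j⟩
  have fi : ∀ i, Function.Injective (f i) := by
    intro i j k h
    simpa [f] using h
  have fchain : ∀ i (l : List (Fin (t i))), List.IsChain (fun x y => finRotate (t i) x = y) l →
      List.IsChain (fun x y => (initial t).boundaryStep x = y) (l.map (f i)) := by
    intro i l hl
    rw [List.isChain_map]
    refine hl.imp fun x y hxy => ?_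
    simp [boundaryStep, initial, next, f, hxy]
  set P := initial t with hPdef
  have hm0 : P.moves = 0 := rfl
  have hPo : ∀ d, P.opp d = d := fun d => rfl
  have hPw : P.WellFormed := ⟨fun d => rfl, fun d _ => rfl⟩
  set a := f 0 a' with ha
  set b := f 1 b' with hb
  set u := u'.map (f 0) with hu
  set v := v'.map (f 1) with hv
  have hab : a ≠ b := by simp [ha, hb, f]
  have hta : P.IsTip a := ⟨trivial, rfl⟩
  have htb : P.IsTip b := ⟨trivial, rfl⟩
  -- The two spots lie on different boundary components, so this move divides nothing and face 0
  -- remains the only face.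
  let Q : Position t := ⟨1, P.joinOpp a b, fun _ => 0⟩
  have ho : Q.opp = P.joinOpp a b := rfl
  have hm : Q.moves = P.moves + 1 := rfl
  have noadj : ∀ v w, ¬ P.graph.Adj v w := by
    intro v w
    rw [graph_adj hPw]
    rintro ⟨-, d, hd, -⟩
    exact hd rfl
  have hgP : P.GirthAtLeast 4 :=
    ⟨fun d hd => absurd rfl hd, fun d _ hd => absurd rfl hd,
      four_le_egirth_iff.2 fun u v _ huv => absurd huv (noadj u v)⟩
  have hadj := fun v w => graph_adj_join hPw hta htb hab hm ho (v := v) (w := w)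
  have hg : Q.GirthAtLeast 4 :=
    girthAtLeast_join hPw hta htb hab hm ho hgP (by simp [ha, hb, f, vert]) (noadj _ _)
  obtain ⟨sa, s1, s2, sb, s3, s0⟩ := boundaryStep_join hPw hta htb hab ho
  have hnd : (a :: u ++ b :: v).Nodup := by
    have e1 : a :: u = (a' :: u').map (f 0) := rfl
    have e2 : b :: v = (b' :: v').map (f 1) := rfl
    rw [e1, e2, List.nodup_append]
    refine ⟨hu1.map (fi 0), hv1.map (fi 1), ?_⟩
    simp only [List.mem_map]
    rintro _ ⟨x, -, rfl⟩ _ ⟨y, -, rfl⟩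
    simp [f]
  have hdr : ∀ d ∈ a :: u ++ b :: v, P.Drawn d := by
    intro d hd
    simp only [ha, hb, hu, hv, List.mem_append, List.mem_cons, List.mem_map] at hd
    rcases hd with (rfl | ⟨x, -, rfl⟩) | (rfl | ⟨x, -, rfl⟩) <;> trivial
  have other : ∀ d ∈ u ++ v, d ≠ a ∧ d ≠ b ∧ d ≠ Sum.inr (P.moves, 0) ∧
      d ≠ Sum.inr (P.moves, 2) := by
    intro d hd
    have hd' := hdr d (by simp only [List.mem_append, List.mem_cons] at hd ⊢; tauto)
    refine ⟨?_, ?_, hd'.ne_new 0, hd'.ne_new 2⟩ <;> rintro rfl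
    · simp only [List.cons_append, List.nodup_cons, List.mem_append, List.mem_cons] at hnd hd
      tauto
    · simp only [List.cons_append, List.nodup_cons, List.nodup_append, List.mem_append,
        List.mem_cons] at hnd hd
      grind
  have otherStep : ∀ d ∈ u ++ v, Q.boundaryStep d = P.boundaryStep d := fun d hd =>
    boundaryStep_join_other ho (other d hd).1 (other d hd).2.1 (other d hd).2.2.1
      (other d hd).2.2.2
  have otherOpp : ∀ d ∈ u ++ v, Q.opp d = d := fun d hd =>
    joinOpp_other (other d hd).1 (other d hd).2.1 (other d hd).2.2.1 (other d hd).2.2.2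
  set l : List (Arm t) := a :: Sum.inr (P.moves, 1) :: Sum.inr (P.moves, 2) :: (v ++
    b :: Sum.inr (P.moves, 3) :: Sum.inr (P.moves, 0) :: u) with hl
  have hdrawn : ∀ d, Q.Drawn d ↔ d ∈ l := by
    intro d
    rw [drawn_succ_iff hm]
    constructor
    · rintro (h | ⟨s, rfl⟩)
      · rcases d with ⟨i, j⟩ | ⟨k, s⟩
        · have hj : Sum.inl ⟨i, j⟩ ∈ a :: u ∨ Sum.inl ⟨i, j⟩ ∈ b :: v := by
            fin_cases i
            · exact Or.inl (List.mem_map_of_mem (f := f 0) (hu2 j))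
            · exact Or.inr (List.mem_map_of_mem (f := f 1) (hv2 j))
          simp only [hl, List.mem_cons, List.mem_append] at hj ⊢
          tauto
        · simp [Drawn, hm0] at h
      · fin_cases s <;> simp [hl]
    · intro h
      simp only [hl, List.mem_cons, List.mem_append] at h
      rcases h with h | h | h | h | h | h | h | h
      · exact Or.inl (hdr d (by simp [h]))
      · exact Or.inr ⟨_, h⟩
      · exact Or.inr ⟨_, h⟩
      · exact Or.inl (hdr d (by simp [h]))
      · exact Or.inl (hdr d (by simp [h]))
      · exact Or.inr ⟨_, h⟩
      · exact Or.inr ⟨_, h⟩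
      · exact Or.inl (hdr d (by simp [h]))
  have hB : Q.Boundaries [l] :=
    { toWellFormed := wellFormed_join hPw hta htb hab hm ho
      girth := hg
      face_le := fun d _ => Nat.zero_le _
      nodup := by
        have f0 := fun h => P.not_drawn_new 0 (hdr _ h)
        have f1 := fun h => P.not_drawn_new 1 (hdr _ h)
        have f2 := fun h => P.not_drawn_new 2 (hdr _ h)
        have f3 := fun h => P.not_drawn_new 3 (hdr _ h)
        simp only [hl, List.flatten_cons, List.flatten_nil, List.append_nil, List.cons_append,
          List.nodup_cons, List.mem_append, List.mem_cons, List.nodup_append,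
          Sum.inr.injEq, Prod.mk.injEq, true_and, not_or] at hnd f0 f1 f2 f3 ⊢
        grind
      drawn_iff := fun d => by simpa using hdrawn d
      chain := by
        intro l' hl'
        obtain rfl := List.mem_singleton.1 hl'
        have c1 := fchain 0 _ hu4
        have c2 := fchain 1 _ hv4
        simp only [List.map_append, List.map_cons, List.map_nil] at c1 c2
        rw [hl, Cycle.chain_coe_cons]
        simp only [List.cons_append, List.append_assoc, List.isChain_cons_cons]
        refine ⟨sa, s1, ?_⟩
        rw [← List.cons_append, List.isChain_split]
        refine ⟨isChain_cons_replace c2 s2 fun d hd => otherStep d (by simp [hd]), ?_⟩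
        simp only [List.isChain_cons_cons]
        exact ⟨sb, s3, isChain_cons_replace c1 s0 fun d hd => otherStep d (by simp [hd])⟩
      face_iff := by
        intro l' hl' d _ e he
        obtain rfl := List.mem_singleton.1 hl'
        exact iff_of_true rfl ((hdrawn e).1 he) }
  -- Without edges, a boundary walk just circles its vertex, so it never passes from one spot to the
  -- other.
  have hns : ¬ P.boundaryStep.SameCycle a b := by
    rintro ⟨i, hi⟩
    have hinv : ∀ d, vert (P.boundaryStep d) = vert d := by
      rintro (⟨i, j⟩ | ⟨k, s⟩) <;> rfl
    have hz : ∀ (i : ℤ) d, vert ((P.boundaryStep ^ i) d) = vert d := by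
      intro i
      induction i with
      | zero => simp
      | succ i ih => intro d; rw [zpow_add_one, Perm.mul_apply, ih, hinv]
      | pred i ih =>
        intro d
        rw [zpow_sub_one, Perm.mul_apply, ih, ← hinv (P.boundaryStep⁻¹ d),
          ← Perm.mul_apply, mul_inv_cancel, Perm.one_apply]
    have := hz i a
    rw [hi] at this
    simp [ha, hb, f, vert] at this
  refine ⟨Q, ⟨⟨a, b, hta, htb, hab, rfl, rfl, rfl, fun d _ => Or.inl rfl,
    fun h => absurd h hns, fun d _ => rfl⟩, hg⟩, rfl, ⟨[l], [], hB, ?_, by simp⟩, ?_⟩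
  · have tip : ∀ s, s ≠ 0 → s ≠ 2 → Q.opp (Sum.inr (P.moves, s)) = Sum.inr (P.moves, s) := by
      intro s h0 h2
      rw [ho, joinOpp_other (hta.1.ne_new s).symm (htb.1.ne_new s).symm (by simpa using h0)
        (by simpa using h2), hPo]
    have na : Q.opp a ≠ a := by
      rw [ho, joinOpp_left hPw hta htb hab]
      exact (hta.1.ne_new 0).symm
    have nb : Q.opp b ≠ b := by
      rw [ho, joinOpp_right hPw hta htb hab]
      exact (htb.1.ne_new 2).symm
    have n0 : Q.opp (Sum.inr (P.moves, 0)) ≠ Sum.inr (P.moves, 0) := by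
      rw [ho, joinOpp_zero hPw hta htb hab]
      exact hta.1.ne_new 0
    have n2 : Q.opp (Sum.inr (P.moves, 2)) ≠ Sum.inr (P.moves, 2) := by
      rw [ho, joinOpp_two hPw hta htb hab]
      exact htb.1.ne_new 2
    have wu : Q.word u = List.replicate (t 0 - 1) (Sum.inl 0) := by
      rw [word, List.filter_eq_self.2 fun d hd => by simpa using otherOpp d (by simp [hd]),
        List.eq_replicate_iff]
      refine ⟨by simp [hu, hu3], ?_⟩
      simp [hu, f, vert]
    have wv : Q.word v = List.replicate (t 1 - 1) (Sum.inl 1) := by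
      rw [word, List.filter_eq_self.2 fun d hd => by simpa using otherOpp d (by simp [hd]),
        List.eq_replicate_iff]
      refine ⟨by simp [hv, hv3], ?_⟩
      simp [hv, f, vert]
    rw [List.map_singleton, hl, word_cons_of_ne na, word_cons_of_tip (tip 1 (by decide) (by decide)),
      word_cons_of_ne n2, word_append, word_cons_of_ne nb,
      word_cons_of_tip (tip 3 (by decide) (by decide)), word_cons_of_ne n0, wu, wv]
    rfl
  · rw [hadj]
    simp [noadj]

end Position

end BrusselsSprout

/-! ### The two strategies after the first move -/

namespace BrusselsSprout

namespace Position

variable {n : ℕ} {t : Fin n → ℕ}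

/-- A play from the position `P` ends after exactly `N` further moves. -/
inductive EndsAfter (g : ℕ) : Position t → ℕ → Prop
  | stuck {P : Position t} : (∀ Q, ¬ P.Move g Q) → EndsAfter g P 0
  | move {P Q : Position t} {N : ℕ} : P.Move g Q → EndsAfter g Q N → EndsAfter g P (N + 1)

theorem EndsAfter.exists_play {g : ℕ} {P : Position t} {N : ℕ} (h : EndsAfter g P N) :
    ∃ s : ℕ → Position t, s 0 = P ∧ (∀ i < N, (s i).Move g (s (i + 1))) ∧
      ∀ Q, ¬ (s N).Move g Q := by
  induction h with
  | @stuck P hP => exact ⟨fun _ => P, rfl, by simp, hP⟩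
  | @move P Q N hm _ ih =>
    obtain ⟨s, h0, hs, hN⟩ := ih
    refine ⟨fun i => i.casesOn P s, rfl, ?_, hN⟩
    rintro (_ | i) hi
    · change P.Move g (s 0)
      rwa [h0]
    · exact hs i (by omega)

theorem settled_singleton (P : Position t) (x : Vertex n) : P.Settled [x] := by
  simp [Settled]

theorem settled_cons_replicate {P : Position t} {x y : Vertex n} (h : P.graph.Adj x y) (k : ℕ) :
    P.Settled (x :: List.replicate k y) := by
  have h' := h.symm
  intro v hv w hw
  simp only [List.mem_cons, List.mem_replicate] at hv hw
  rcases hv with rfl | ⟨-, rfl⟩ <;> rcases hw with rfl | ⟨-, rfl⟩ <;> simp [h, h']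

/-- The cyclic word of a face whose tips are `j` tips at the spot `β` and `i` tips at the spot `α`,
separated by tips at the crossings `k` and `k'`. -/
def mainWord (α β : Fin n) (k k' i j : ℕ) : List (Vertex n) :=
  Sum.inr k :: (List.replicate j (Sum.inl β) ++ Sum.inr k' :: List.replicate i (Sum.inl α))

/-- Joining the tips of a two-letter face leaves two faces with one tip each. -/
theorem Stage.exists_move_pair {P : Position t} {x y : Vertex n} {ws : List (List (Vertex n))}
    (h : P.Stage ([x, y] :: ws)) (hxy : x ≠ y) (hadj : ¬ P.graph.Adj x y) :
    ∃ Q : Position t, P.Move 4 Q ∧ Q.moves = P.moves + 1 ∧ Q.Stage ws ∧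
      ∀ v w, Q.graph.Adj v w ↔ P.graph.Adj v w ∨
        (v = Sum.inr P.moves ∧ (w = x ∨ w = y)) ∨ (w = Sum.inr P.moves ∧ (v = x ∨ v = y)) := by
  obtain ⟨Q, hm, hQ, hs, ha⟩ := Stage.exists_move (w₀ := []) (u := []) (v := []) h hxy hadj
  exact ⟨Q, hm, hQ, (hs.settle (settled_singleton _ _)).settle (settled_singleton _ _), ha⟩

theorem Stage.endsAfter_nil {P : Position t} (h : P.Stage []) : EndsAfter 4 P 0 :=
  .stuck h.not_move

theorem Stage.endsAfter_pair {P : Position t} {x y : Vertex n} (h : P.Stage [[x, y]])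
    (hxy : x ≠ y) (hadj : ¬ P.graph.Adj x y) : EndsAfter 4 P 1 := by
  obtain ⟨Q, hm, -, hs, -⟩ := h.exists_move_pair hxy hadj
  exact .move hm hs.endsAfter_nil

/-- Joining the first tip at `β` to the last tip at `α` cuts off the crossing `k`. -/
theorem Stage.exists_move_mainWord {P : Position t} {α β : Fin n} {k k' i j : ℕ}
    {ws : List (List (Vertex n))} (h : P.Stage (mainWord α β k k' (i + 1) (j + 1) :: ws))
    (hne : α ≠ β) (hadj : ¬ P.graph.Adj (Sum.inl β) (Sum.inl α)) :
    ∃ Q : Position t, P.Move 4 Q ∧ Q.moves = P.moves + 1 ∧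
      Q.Stage ([Sum.inr P.moves, Sum.inr k] :: mainWord α β P.moves k' i j :: ws) ∧
      ∀ v w, Q.graph.Adj v w ↔ P.graph.Adj v w ∨
        (v = Sum.inr P.moves ∧ (w = Sum.inl β ∨ w = Sum.inl α)) ∨
        (w = Sum.inr P.moves ∧ (v = Sum.inl β ∨ v = Sum.inl α)) := by
  have e : mainWord α β k k' (i + 1) (j + 1) = [Sum.inr k] ++ Sum.inl β ::
      ((List.replicate j (Sum.inl β) ++ Sum.inr k' :: List.replicate i (Sum.inl α)) ++
        Sum.inl α :: []) := by
    simp [mainWord, List.replicate_succ (n := j), List.replicate_succ' (n := i)]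
  rw [e] at h
  obtain ⟨Q, hm, hQ, hs, ha⟩ := h.exists_move (by simpa using hne.symm) hadj
  exact ⟨Q, hm, hQ, hs.perm (.swap _ _ _), ha⟩

/-- Joining the second tip at `β` to the last tip at `α` cuts off the crossing `k` together with
one tip at `β`. -/
theorem Stage.exists_move_mainWord_two {P : Position t} {α β : Fin n} {k k' i j : ℕ}
    {ws : List (List (Vertex n))} (h : P.Stage (mainWord α β k k' (i + 1) (j + 2) :: ws))
    (hne : α ≠ β) (hadj : ¬ P.graph.Adj (Sum.inl β) (Sum.inl α)) :
    ∃ Q : Position t, P.Move 4 Q ∧ Q.moves = P.moves + 1 ∧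
      Q.Stage ([Sum.inr P.moves, Sum.inr k, Sum.inl β] :: mainWord α β P.moves k' i j :: ws) ∧
      ∀ v w, Q.graph.Adj v w ↔ P.graph.Adj v w ∨
        (v = Sum.inr P.moves ∧ (w = Sum.inl β ∨ w = Sum.inl α)) ∨
        (w = Sum.inr P.moves ∧ (v = Sum.inl β ∨ v = Sum.inl α)) := by
  have e : mainWord α β k k' (i + 1) (j + 2) = [Sum.inr k, Sum.inl β] ++ Sum.inl β ::
      ((List.replicate j (Sum.inl β) ++ Sum.inr k' :: List.replicate i (Sum.inl α)) ++
        Sum.inl α :: []) := by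
    simp [mainWord, List.replicate_succ (n := j), List.replicate_succ (n := j + 1),
      List.replicate_succ' (n := i)]
  rw [e] at h
  obtain ⟨Q, hm, hQ, hs, ha⟩ := h.exists_move (by simpa using hne.symm) hadj
  exact ⟨Q, hm, hQ, hs.perm (.swap _ _ _), ha⟩

/-- A face with one tip each at two nonadjacent crossings and a spot is cut, in two moves, into
faces with one tip each. -/
theorem Stage.exists_two_moves {P : Position t} {β : Fin n} {k k' : ℕ}
    {ws : List (List (Vertex n))} (h : P.Stage ([Sum.inr k, Sum.inr k', Sum.inl β] :: ws))
    (hk : k ≠ k') (hadj : ¬ P.graph.Adj (Sum.inr k) (Sum.inr k')) :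
    ∃ Q R : Position t, P.Move 4 Q ∧ Q.Move 4 R ∧ R.moves = P.moves + 2 ∧ R.Stage ws ∧
      ∀ v w, v ≠ Sum.inr P.moves → v ≠ Sum.inr (P.moves + 1) → w ≠ Sum.inr P.moves →
        w ≠ Sum.inr (P.moves + 1) → (R.graph.Adj v w ↔ P.graph.Adj v w) := by
  obtain ⟨Q, hm, hQ, hs, ha⟩ := Stage.exists_move (w₀ := []) (u := []) (v := [Sum.inl β]) h
    (by simpa using hk) hadj
  obtain ⟨R, hm', hR, hs', ha'⟩ := (hs.settle (settled_singleton _ _)).exists_move_pair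
    (by simp) (by simp [ha, not_adj_new h.wellFormed])
  refine ⟨Q, R, hm, hm', by omega, hs', fun v w h1 h2 h3 h4 => ?_⟩
  rw [ha', ha, hQ]
  tauto

/-- Each round spends one tip at `α` and one or two at `β`, and makes as many moves as it spends
tips. The crossing `k'` stays while `k` is renewed each round, so `k` and `k'` need to differ only
once no tip at `α` is left. -/
theorem Stage.endsAfter_mainWord {P : Position t} {α β : Fin n} {k k' i j : ℕ}
    (h : P.Stage [mainWord α β k k' i j]) (hne : α ≠ β)
    (hadj : ¬ P.graph.Adj (Sum.inl β) (Sum.inl α)) (hk : i = 0 → k ≠ k')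
    (hkk : ¬ P.graph.Adj (Sum.inr k) (Sum.inr k')) (hij : i ≤ j) (hji : j ≤ 2 * i + 1) :
    EndsAfter 4 P (i + j + 1) := by
  induction i generalizing P k j with
  | zero =>
    -- Joining `k` and `k'` finishes `j = 0`; for `j = 1` it leaves the new crossing and one tip at
    -- `β`, worth one more move.
    obtain rfl | rfl : j = 0 ∨ j = 1 := by omega
    · exact h.endsAfter_pair (by simpa using hk) hkk
    · obtain ⟨Q, hm, -, hs, ha⟩ := Stage.exists_move (w₀ := []) (x := Sum.inr k)
        (u := [Sum.inl β]) (y := Sum.inr k') (v := []) h (by simpa using hk) hkk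
      have hs' := (hs.perm (.swap _ _ _)).settle (settled_singleton _ _)
      exact .move hm (hs'.endsAfter_pair (by simp) (by simp [ha, not_adj_new h.wellFormed]))
  | succ i ih =>
    have hkn : k ≠ P.moves :=
      (h.lt_moves List.mem_cons_self (by simp [mainWord])).ne
    have hk' : k' < P.moves := h.lt_moves List.mem_cons_self (by simp [mainWord])
    have hkn' : k' ≠ P.moves := hk'.ne
    have hkQ : k' ≠ P.moves + 1 := by omega
    have hkR : k' ≠ P.moves + 2 := by omega
    have nn : ∀ v, ¬ P.graph.Adj (Sum.inr P.moves) v := fun v => not_adj_new h.wellFormed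
    -- Spending one tip at `β` keeps the bound `j ≤ 2 * i + 1` unless `j = 2 * i + 3`; in that
    -- extreme case two tips are spent.
    by_cases hj : j ≤ 2 * (i + 1)
    · obtain ⟨j, rfl⟩ : ∃ k, j = k + 1 := ⟨j - 1, by omega⟩
      obtain ⟨Q, hm, hQ, hs, ha⟩ := h.exists_move_mainWord hne hadj
      obtain ⟨R, hm', hR, hs', ha'⟩ := hs.exists_move_pair (by simpa using hkn.symm)
        (by simp [ha, nn, hkn])
      have hR' := ih hs' (by simp [ha', ha, hadj]) (fun _ => hkn'.symm)
        (by simp [ha', ha, nn, hQ, hkQ, hkn']) (by omega) (by omega)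
      exact cast (by congr 1; omega) (EndsAfter.move hm (EndsAfter.move hm' hR'))
    · obtain ⟨j, rfl⟩ : ∃ k, j = k + 2 := ⟨j - 2, by omega⟩
      obtain ⟨Q, hm, hQ, hs, ha⟩ := h.exists_move_mainWord_two hne hadj
      obtain ⟨R, S, hm', hm'', hR, hs', ha'⟩ := hs.exists_two_moves hkn.symm
        (by simp [ha, nn, hkn])
      have hS := ih hs' (by rw [ha'] <;> simp [ha, hadj]) (fun _ => hkn'.symm)
        (by rw [ha'] <;> simp [ha, nn, hQ, hkQ, hkn', hkR]; omega) (by omega) (by omega)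
      exact cast (by congr 1; omega)
        (EndsAfter.move hm (EndsAfter.move hm' (EndsAfter.move hm'' hS)))

theorem Stage.endsAfter_five {P : Position t} {α β : Fin n} {k i j : ℕ}
    (h : P.Stage [mainWord α β k k (i + 2) (j + 2)]) (hne : α ≠ β)
    (hadj : ¬ P.graph.Adj (Sum.inl β) (Sum.inl α)) : EndsAfter 4 P 5 := by
  have hk : k < P.moves := h.lt_moves List.mem_cons_self (by simp [mainWord])
  have hkn : k ≠ P.moves := hk.ne
  have nn : ∀ v, ¬ P.graph.Adj (Sum.inr P.moves) v := fun v => not_adj_new h.wellFormed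
  obtain ⟨Q, hm, hQ, hs, ha⟩ := h.exists_move_mainWord hne hadj
  obtain ⟨R, hm', hR, hs', ha'⟩ := hs.exists_move_pair (by simpa using hkn.symm)
    (by simp [ha, nn, hkn])
  have hkQ : k ≠ P.moves + 1 := by omega
  -- The first round was needed because both crossing tips belonged to `k`. Now they are at distinct
  -- nonadjacent crossings, and joining them separates `β` from `α`.
  obtain ⟨S, hmS, hS, hsS, haS⟩ := Stage.exists_move (w₀ := []) (x := Sum.inr P.moves)
    (u := List.replicate (j + 1) (Sum.inl β)) (y := Sum.inr k)
    (v := List.replicate (i + 1) (Sum.inl α)) hs' (by simpa using hkn.symm)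
    (by simp [ha', ha, nn, hkn, hQ, hkQ])
  have nnR : ∀ v, ¬ R.graph.Adj (Sum.inr R.moves) v := fun v => not_adj_new hs'.wellFormed
  rw [List.replicate_succ, List.append_nil, List.replicate_succ] at hsS
  -- The crossing made by this move is adjacent to `β`, so the remaining tips at `β` are settled;
  -- the next move does the same at `α`.
  obtain ⟨T, hmT, hT, hsT, haT⟩ := Stage.exists_move (w₀ := []) (x := Sum.inr R.moves)
    (u := []) (y := Sum.inl β) (v := List.replicate j (Sum.inl β)) hsS (by simp)
    (by simp [haS, nnR])
  rw [List.append_nil] at hsT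
  have hsT' := (hsT.settle (settled_singleton _ _)).settle
    (settled_cons_replicate (by simp [haT]) _)
  have hRS : R.moves ≠ S.moves := by omega
  obtain ⟨U, hmU, hU, hsU, haU⟩ := Stage.exists_move (w₀ := []) (x := Sum.inr R.moves)
    (u := []) (y := Sum.inl α) (v := List.replicate i (Sum.inl α)) hsT' (by simp)
    (by simp [haT, haS, nnR, hRS])
  rw [List.append_nil] at hsU
  have hsU' := (hsU.settle (settled_singleton _ _)).settle
    (settled_cons_replicate (by simp [haU]) _)
  exact .move hm (.move hm' (.move hmS (.move hmT (.move hmU hsU'.endsAfter_nil))))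

end Position

end BrusselsSprout

/-! ### The theorem -/

open BrusselsSprout Position in
theorem mainTheorem11 (p q : ℕ) (hp : 3 ≤ p) (hpq : p ≤ q) (hq : q ≤ 2 * p) :
    BrusselsSprout.HasPlayEndingAfter 4 ![p, q] (p + q) ∧
      BrusselsSprout.HasPlayEndingAfter 4 ![p, q] 6 := by
  obtain ⟨i, rfl⟩ : ∃ i, p = i + 3 := ⟨p - 3, by omega⟩
  obtain ⟨j, rfl⟩ : ∃ j, q = j + 3 := ⟨q - 3, by omega⟩
  obtain ⟨Q, hm, -, hs, hadj⟩ := exists_first_move (t := ![i + 3, j + 3]) (by simp) (by simp)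
  have hs' : Q.Stage [mainWord 0 1 0 0 (i + 2) (j + 2)] := hs
  have hadj' : ¬ Q.graph.Adj (Sum.inl 1) (Sum.inl 0) := fun h => hadj h.symm
  refine ⟨EndsAfter.exists_play ?_, EndsAfter.exists_play (.move hm (hs'.endsAfter_five ?_ hadj'))⟩
  -- One tip of each spot is already used, so the bounds read p - 1 ≤ q - 1 ≤ 2(p - 1) + 1, that is,
  -- p ≤ q ≤ 2p. Both crossings are 0 here, which is allowed since tips at `α` remain.
  · have := hs'.endsAfter_mainWord (by simp) hadj' (by simp) (by simp) (by omega) (by omega)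
    exact cast (by congr 1; omega) (EndsAfter.move hm this)
  · simp
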